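/- Conventions. The highest-degree part of a real polynomial $p$ is denoted $p^{hom}$, and $\tilde p(x_0,x)=x_0^{\deg p}\,p(x/x_0)$ is its homogenization. For $N$ forms $F_1,\dots,F_N$ of degrees $d_1,\dots,d_N$ in $N$ variables, $Res(F_1,\dots,F_N)$ is the resultant: its polynomial is the generator, unique up to sign, of the elimination ideal of the generic forms of these degrees, i.e. of the ideal of all integral polynomials $R$ in the coefficients such that every variable $x_s$ has a power with $x_s^{K} R$ in the ideal generated by the generic forms. For one form $F$ of degree $d\neq 1$ in $N$ variables, $\Delta(F)=Res(\partial F/\partial x_1,\dots,\partial F/\partial x_N)$, the partial derivatives being regarded as forms of degree $\max(d-1,0)$. For $2\le m\le N$ forms in $N$ variables, of degrees not all equal to $1$, $\Delta(F_1,\dots,F_m)$ is the discriminant, whose polynomial is the generator, unique up to sign, of the elimination ideal of the generic forms together with the maximal minors of their Jacobian matrix (for $m=N$ it is the resultant). If all the forms are linear, $\Delta$ denotes the Gram determinant of their coefficient vectors, so that $\Delta\neq 0$ means that they are linearly independent ($\Delta=1$ for the empty family). For inhomogeneous polynomials, $Res$ and $\Delta$ are those of the homogenizations. (For forms of positive degree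 the elimination ideals used here are principal; in a degenerate case with forms of degree $0$ where the ideal is not principal, the value is taken to be $0$.) Theorem. Let $f,h_1,\dots,h_{m_1},g_1,\dots,g_{m_2}\in\mathbb R[x_1,\dots,x_n]$, and let $S=\{x\in\mathbb R^n: h_i(x)=0 \ \forall i,\ g_j(x)\ge 0\ \forall j\}$. (a) If $m_1>n$ and $Res(h_{i_1},\dots,h_{i_{n+1}})\ne 0$ for some $\{i_1,\dots,i_{n+1}\}\subset\{1,\dots,m_1\}$, then $S=\emptyset$. (b) If $m_1\le n$ and $Res(h_1,\dots,h_{m_1},g_{j_1},\dots,g_{j_{n-m_1+1}})\neq 0$ for every $\{j_1,\dots,j_{n-m_1+1}\}\subset\{1,\dots,m_2\}$, then for every $u\in S$ at most $n-m_1$ of $g_1(u),\dots,g_{m_2}(u)$ vanish. (c) If $m_1\le n$ and $\Delta(h_1,\dots,h_{m_1},g_{j_1},\dots,g_{j_k})\ne 0$ for every $\{j_1,\dots,j_k\}\subset\{1,\dots,m_2\}$ with $0\le k\le n-m_1$, then for every $J\subset\{1,\dots,m_2\}$ with $|J|\le n-m_1$ the Jacobian matrix of $(h,g_J)$ has full rank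 $m_1+|J|$ at every point of $V(h,g_J)=\{x\in\mathbb C^n: h(x)=0,\ g_J(x)=0\}$. (d) Let $S^{prj}=\{\tilde x=(x_0,\dots,x_n)\in\mathbb R^{n+1}:\tilde h_i(\tilde x)=0\ \forall i,\ \tilde g_j(\tilde x)\ge0\ \forall j\}$. Suppose that $S\ne\emptyset$, that $S$ is closed at $\infty$, i.e. $S^{prj}\cap\{x_0\ge0\}$ is the closure of $S^{prj}\cap\{x_0>0\}$, and that $f$ is bounded below on $S$. If the resultant of any $n$ of the forms $h_i^{hom},g_j^{hom}$ is nonzero (a condition only when $m_1+m_2\ge n$), and $\Delta(f^{hom},h_1^{hom},\dots,h_{m_1}^{hom},g_{j_1}^{hom},\dots,g_{j_k}^{hom})\ne0$ for every $\{j_1,\dots,j_k\}\subset\{1,\dots,m_2\}$ with $0\le k\le n-m_1-1$, then there is $v\in S$ with $f(v)=\min_{x\in S}f(x)$. (e) If $f$ is bounded below on $\mathbb R^n$ and $\Delta(f^{hom})\neq0$, then $f$ attains its minimum on $\mathbb R^n$. -/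

import Mathlib

open MvPolynomial

noncomputable section

namespace PolyOpt

/-! ### Forms attached to a polynomial -/

/-- The homogeneous part of highest degree of `p`. -/
def topForm {n : ℕ} (p : MvPolynomial (Fin n) ℝ) : MvPolynomial (Fin n) ℝ :=
  homogeneousComponent p.totalDegree p

/-- The homogenization `x₀ ^ deg p * p (x / x₀)`, a form of degree `deg p` in `x₀, …, xₙ`. -/
def homogenization {n : ℕ} (p : MvPolynomial (Fin n) ℝ) : MvPolynomial (Fin (n + 1)) ℝ :=
  ∑ k ∈ Finset.range (p.totalDegree + 1),
    X 0 ^ (p.totalDegree - k) * rename Fin.succ (homogeneousComponent k p)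

/-! ### Resultants and discriminants of families of forms

The forms are indexed by a finite type `ι` and their variables by a finite type `σ`;
`d i` is the (nominal) degree of the `i`-th form. -/

section Elimination

variable {ι σ : Type} [Fintype ι] [Fintype σ]

open Classical in
/-- The exponents of the monomials of degree `k` in the variables `σ`. -/
def monomialsOfDegree (σ : Type) [Fintype σ] (k : ℕ) : Finset (σ →₀ ℕ) :=
  Finset.univ.finsuppAntidiag k

/-- One index for each coefficient of a family of forms of degrees `d i`. -/
abbrev CoeffIndex (σ : Type) [Fintype σ] (d : ι → ℕ) : Type :=
  (i : ι) × ↥(monomialsOfDegree σ (d i))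

/-- The universal ring of coefficients of a family of forms of degrees `d i`:
the integral polynomials with one indeterminate for each coefficient. -/
abbrev CoeffRing (σ : Type) [Fintype σ] (d : ι → ℕ) : Type :=
  MvPolynomial (CoeffIndex σ d) ℤ

/-- The generic form of degree `d i`: its coefficients are independent indeterminates. -/
def genericForm (σ : Type) [Fintype σ] (d : ι → ℕ) (i : ι) : MvPolynomial σ (CoeffRing σ d) :=
  ∑ α : ↥(monomialsOfDegree σ (d i)), monomial (α : σ →₀ ℕ) (X ⟨i, α⟩)

/-- The elimination ideal of an ideal `I` of `A[x]`, homogeneous in `x`: all `a ∈ A` such that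
every variable `s` has a power with `a * x_s ^ N ∈ I`. -/
def eliminationIdeal {A : Type} [CommRing A] (I : Ideal (MvPolynomial σ A)) : Ideal A where
  carrier := {a | ∀ s : σ, ∃ N : ℕ, C a * X s ^ N ∈ I}
  zero_mem' := fun s => ⟨0, by simp⟩
  add_mem' := by
    intro a b ha hb s
    obtain ⟨N, hN⟩ := ha s
    obtain ⟨M, hM⟩ := hb s
    refine ⟨N + M, ?_⟩
    have h1 := I.mul_mem_right (X s ^ M) hN
    have h2 := I.mul_mem_right (X s ^ N) hM
    have h3 := I.add_mem h1 h2
    convert h3 using 1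
    rw [C_add]
    ring
  smul_mem' := by
    intro c a ha s
    obtain ⟨N, hN⟩ := ha s
    refine ⟨N, ?_⟩
    have h1 := I.mul_mem_left (C c) hN
    convert h1 using 1
    rw [smul_eq_mul, C_mul]
    ring

open Classical in
/-- The generator of a principal ideal (unique up to a unit), and `0` for any other ideal. -/
def idealGenerator {A : Type} [CommRing A] (I : Ideal A) : A :=
  if h : Submodule.IsPrincipal I then @Submodule.IsPrincipal.generator A A _ _ _ I h else 0

/-- The ideal generated by the generic forms of degrees `d i`. -/
def genericIdeal (σ : Type) [Fintype σ] (d : ι → ℕ) : Ideal (MvPolynomial σ (CoeffRing σ d)) :=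
  Ideal.span (Set.range (genericForm σ d))

open Classical in
/-- The ideal generated by the generic forms of degrees `d i` and by the maximal minors of their
Jacobian matrix; a minor is given by a choice `r` of one variable for each form. -/
def genericSingularIdeal (σ : Type) [Fintype σ] (d : ι → ℕ) :
    Ideal (MvPolynomial σ (CoeffRing σ d)) :=
  genericIdeal σ d ⊔ Ideal.span (Set.range fun r : ι → σ =>
    Matrix.det (Matrix.of fun i j : ι => pderiv (r j) (genericForm σ d i)))

/-- The value of an integral polynomial in the coefficients at a given family of real forms. -/
def evalAtCoeffs (d : ι → ℕ) (F : ι → MvPolynomial σ ℝ) (P : CoeffRing σ d) : ℝ :=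
  aeval (fun c : CoeffIndex σ d => coeff (c.2 : σ →₀ ℕ) (F c.1)) P

/-- The resultant polynomial of as many forms as variables, of degrees `d i ≥ 1`: the generator
(unique up to sign) of the elimination ideal of the generic forms of these degrees. It is the
irreducible integral polynomial in the coefficients that vanishes exactly at the systems with
a nonzero common complex zero. -/
def resultantPoly (σ : Type) [Fintype σ] (d : ι → ℕ) : CoeffRing σ d :=
  idealGenerator (eliminationIdeal (genericIdeal σ d))

/-- The resultant of forms `F i` of degrees `d i` (as many forms as variables). -/
def resultant (d : ι → ℕ) (F : ι → MvPolynomial σ ℝ) : ℝ :=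
  evalAtCoeffs d F (resultantPoly σ d)

/-- The discriminant of a single form of degree `k`: the resultant of its partial derivatives. -/
def formDiscriminant (k : ℕ) (F : MvPolynomial σ ℝ) : ℝ :=
  resultant (fun _ : σ => k - 1) (fun s : σ => pderiv s F)

/-- The discriminant polynomial of at least two forms, at most as many as variables, of degrees
`d i ≥ 1`, not all equal to `1`: the generator (unique up to sign) of the elimination ideal of the
generic forms together with the maximal minors of their Jacobian matrix. It is the irreducible
integral polynomial in the coefficients that vanishes exactly at the systems with a nonzero
common complex zero at which the gradients are linearly dependent. -/
def discriminantPoly (σ : Type) [Fintype σ] (d : ι → ℕ) : CoeffRing σ d :=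
  idealGenerator (eliminationIdeal (genericSingularIdeal σ d))

open Classical in
/-- The discriminant of forms `F i` of degrees `d i`. Linear forms, which have no discriminant in
the strict sense, get the Gram determinant of their coefficient vectors: it is nonzero if and only
if the forms are linearly independent, that is, if and only if they have no nonzero common zero
with linearly dependent gradients (there being at most as many forms as variables).
For a single form (the product then has one factor) it is the discriminant of that form. -/
def discriminant (d : ι → ℕ) (F : ι → MvPolynomial σ ℝ) : ℝ :=
  if ∀ i, d i = 1 then
    Matrix.det (Matrix.of fun i j : ι =>
      ∑ s : σ, coeff (Finsupp.single s 1) (F i) * coeff (Finsupp.single s 1) (F j))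
  else if Fintype.card ι = 1 then ∏ i, formDiscriminant (d i) (F i)
  else evalAtCoeffs d F (discriminantPoly σ d)

end Elimination

/-- The resultant of `n + 1` (possibly inhomogeneous) polynomials in `n` variables: the resultant
of their homogenizations. -/
def affineResultant {ι : Type} [Fintype ι] {n : ℕ} (p : ι → MvPolynomial (Fin n) ℝ) : ℝ :=
  resultant (fun i => (p i).totalDegree) (fun i => homogenization (p i))

/-- The discriminant of (possibly inhomogeneous) polynomials: the discriminant of their
homogenizations. -/
def affineDiscriminant {ι : Type} [Fintype ι] {n : ℕ} (p : ι → MvPolynomial (Fin n) ℝ) : ℝ :=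
  discriminant (fun i => (p i).totalDegree) (fun i => homogenization (p i))

/-- The resultant of the highest-degree parts of `n` polynomials in `n` variables. -/
def topResultant {ι : Type} [Fintype ι] {n : ℕ} (p : ι → MvPolynomial (Fin n) ℝ) : ℝ :=
  resultant (fun i => (p i).totalDegree) (fun i => topForm (p i))

/-- The discriminant of the highest-degree parts of the given polynomials. -/
def topDiscriminant {ι : Type} [Fintype ι] {n : ℕ} (p : ι → MvPolynomial (Fin n) ℝ) : ℝ :=
  discriminant (fun i => (p i).totalDegree) (fun i => topForm (p i))

/-! ### The optimization problem -/

section Problem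

variable {n m₁ m₂ : ℕ} (h : Fin m₁ → MvPolynomial (Fin n) ℝ) (g : Fin m₂ → MvPolynomial (Fin n) ℝ)

/-- The feasible set `S` of the constraints `h i = 0`, `g j ≥ 0`. -/
def feasibleSet : Set (Fin n → ℝ) :=
  {x | (∀ i, eval x (h i) = 0) ∧ ∀ j, 0 ≤ eval x (g j)}

/-- The projectivization of the feasible set: the set in `ℝⁿ⁺¹` defined by the homogenized
constraints. -/
def projectivization : Set (Fin (n + 1) → ℝ) :=
  feasibleSet (fun i => homogenization (h i)) (fun j => homogenization (g j))

/-- The feasible set is closed at infinity. -/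
def ClosedAtInfinity : Prop :=
  projectivization h g ∩ {x | 0 ≤ x 0} = closure (projectivization h g ∩ {x | 0 < x 0})

/-- The tuple `(h, g_J)`. -/
def constraintTuple (J : Finset (Fin m₂)) : Fin m₁ ⊕ ↥J → MvPolynomial (Fin n) ℝ :=
  Sum.elim h (fun j => g j)

/-- The tuple `(f, h, g_J)`. -/
def objectiveTuple (f : MvPolynomial (Fin n) ℝ) (J : Finset (Fin m₂)) :
    Option (Fin m₁ ⊕ ↥J) → MvPolynomial (Fin n) ℝ :=
  fun o => o.elim f (constraintTuple h g J)

open Classical in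
/-- At every feasible point at most `n - m₁` of the `g j` vanish (used only when `m₁ ≤ n`). -/
def FewActive : Prop :=
  ∀ u ∈ feasibleSet h g, (Finset.univ.filter fun j => eval u (g j) = 0).card ≤ n - m₁

/-- For every `J` with `|J| ≤ n - m₁`, the Jacobian matrix of `(h, g_J)` has full rank at every
point of the complex variety `V(h, g_J)` (used only when `m₁ ≤ n`). -/
def NonsingularVarieties : Prop :=
  ∀ J : Finset (Fin m₂), J.card ≤ n - m₁ → ∀ x : Fin n → ℂ,
    (∀ t, aeval x (constraintTuple h g J t) = 0) →
      (Matrix.of fun (i : Fin n) (t : Fin m₁ ⊕ ↥J) =>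
        aeval x (pderiv i (constraintTuple h g J t))).rank = m₁ + J.card

end Problem

end PolyOpt

end

/-! Only one direction of elimination theory is needed: a resultant or discriminant vanishes at
forms with a nonzero common zero, respectively with one where the gradients are dependent. If `C a *
X s ^ N` lies in the generic ideal for every `s`, then specializing the coefficients to the given
forms and the variables to such a zero, at a nonzero coordinate `s`, forces `a` to specialize to `0`
(`map_eq_zero_of_mem_eliminationIdeal`). Irreducibility of the eliminants plays no role.

Parts (a)-(c) apply this to homogenizations at `(1, x)`. In (d) it suffices that the top form of `f`
is positive on the nonzero feasible points at infinity: sublevel sets are then compact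
(`exists_isMinOn_of_topForm_pos`). Closedness at infinity and the lower bound give nonnegativity
(`topForm_nonneg`). At a nonzero zero `y`, the resultants bound the number of active constraints and
the discriminant makes the gradients independent, so the top forms define an open map at `y` and
that of `f` becomes negative at a nearby feasible point at infinity, a contradiction. In (e), such a
`y` is a minimum of the top form, hence a common zero of its partial derivatives. -/

namespace PolyOpt

/-! ### Specialization of elimination ideals at common zeros -/

section Elimination

variable {ι σ : Type} [Fintype ι] [Fintype σ] {K : Type*} [Field K] [Algebra ℝ K]

/-- The default value `0` also lies in the ideal, so principality never has to be proved. -/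
theorem idealGenerator_mem {A : Type} [CommRing A] (I : Ideal A) : idealGenerator I ∈ I := by
  unfold idealGenerator
  split_ifs with h
  · exact @Submodule.IsPrincipal.generator_mem A A _ _ _ I h
  · exact I.zero_mem

omit [Fintype σ] [Algebra ℝ K] in
/-- An element of the elimination ideal vanishes under every specialization that sends the ideal to
zero at a nonzero point. -/
theorem map_eq_zero_of_mem_eliminationIdeal {A : Type} [CommRing A]
    {I : Ideal (MvPolynomial σ A)} {a : A} (ha : a ∈ eliminationIdeal I) (φ : A →+* K)
    {X₀ : σ → K} (hX : X₀ ≠ 0) (hI : ∀ p ∈ I, eval₂ φ X₀ p = 0) : φ a = 0 := by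
  obtain ⟨s, hs⟩ := Function.ne_iff.mp hX
  obtain ⟨N, hN⟩ := ha s
  have := hI _ hN
  rw [eval₂_mul, eval₂_C, eval₂_pow, eval₂_X] at this
  exact (mul_eq_zero.mp this).resolve_right (pow_ne_zero _ hs)

/-- The specialization of the universal coefficients to those of the forms `F i`. -/
noncomputable def specialize (d : ι → ℕ) (F : ι → MvPolynomial σ ℝ) : CoeffRing σ d →+* ℝ :=
  (aeval fun c : CoeffIndex σ d => coeff (c.2 : σ →₀ ℕ) (F c.1)).toRingHom

theorem mem_monomialsOfDegree {k : ℕ} {α : σ →₀ ℕ} :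
    α ∈ monomialsOfDegree σ k ↔ α.degree = k := by
  classical
  simp [monomialsOfDegree, Finset.mem_finsuppAntidiag, Finsupp.degree_eq_sum]

omit [Fintype ι] in
-- Homogeneity guarantees that the listed monomials of degree `d i` include the whole support of `F
-- i`.
theorem map_specialize_genericForm {d : ι → ℕ} {F : ι → MvPolynomial σ ℝ} {i : ι}
    (hF : (F i).IsHomogeneous (d i)) : map (specialize d F) (genericForm σ d i) = F i := by
  have h1 : map (specialize d F) (genericForm σ d i) =
      ∑ α : ↥(monomialsOfDegree σ (d i)), monomial (α : σ →₀ ℕ) (coeff (α : σ →₀ ℕ) (F i)) := by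
    simp [genericForm, specialize, map_monomial]
  rw [h1, Finset.sum_coe_sort (monomialsOfDegree σ (d i)) fun α => monomial α (coeff α (F i))]
  conv_rhs => rw [(F i).as_sum]
  symm
  refine Finset.sum_subset (fun α hα => ?_) fun α _ hα => ?_
  · rw [mem_monomialsOfDegree]
    by_contra h
    exact mem_support_iff.mp hα (hF.coeff_eq_zero h)
  · rw [notMem_support_iff.mp hα, monomial_zero]

omit [Fintype ι] in
-- Separates real coefficients from a point over `K`, so that part (c) can use complex points.
theorem eval₂_specialize (d : ι → ℕ) (F : ι → MvPolynomial σ ℝ) (X₀ : σ → K)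
    (p : MvPolynomial σ (CoeffRing σ d)) :
    eval₂ ((algebraMap ℝ K).comp (specialize d F)) X₀ p = aeval X₀ (map (specialize d F) p) := by
  rw [aeval_def, eval₂_map]

omit [Fintype ι] in
/-- The resultant of forms with a common nonzero zero vanishes. -/
theorem resultant_eq_zero {d : ι → ℕ} {F : ι → MvPolynomial σ ℝ}
    (hF : ∀ i, (F i).IsHomogeneous (d i)) {X₀ : σ → K} (hX : X₀ ≠ 0)
    (h0 : ∀ i, aeval X₀ (F i) = 0) : resultant d F = 0 := by
  have h := map_eq_zero_of_mem_eliminationIdeal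
    (idealGenerator_mem (eliminationIdeal (genericIdeal σ d)))
    ((algebraMap ℝ K).comp (specialize d F)) hX ?_
  · exact (map_eq_zero_iff _ (algebraMap ℝ K).injective).mp h
  · have : genericIdeal σ d ≤
        RingHom.ker (eval₂Hom ((algebraMap ℝ K).comp (specialize d F)) X₀) := by
      rw [genericIdeal, Ideal.span_le]
      rintro _ ⟨i, rfl⟩
      change eval₂ _ _ _ = 0
      rw [eval₂_specialize, map_specialize_genericForm (hF i), h0]
    exact fun p hp => this hp

open Classical in
theorem evalAtCoeffs_discriminantPoly_eq_zero {d : ι → ℕ} {F : ι → MvPolynomial σ ℝ}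
    (hF : ∀ i, (F i).IsHomogeneous (d i)) {X₀ : σ → K} (hX : X₀ ≠ 0)
    (h0 : ∀ i, aeval X₀ (F i) = 0)
    (hdet : ∀ r : ι → σ, Matrix.det (Matrix.of fun i j : ι => aeval X₀ (pderiv (r j) (F i))) = 0) :
    evalAtCoeffs d F (discriminantPoly σ d) = 0 := by
  have h := map_eq_zero_of_mem_eliminationIdeal
    (idealGenerator_mem (eliminationIdeal (genericSingularIdeal σ d)))
    ((algebraMap ℝ K).comp (specialize d F)) hX ?_
  · exact (map_eq_zero_iff _ (algebraMap ℝ K).injective).mp h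
  · have : genericSingularIdeal σ d ≤
        RingHom.ker (eval₂Hom ((algebraMap ℝ K).comp (specialize d F)) X₀) := by
      rw [genericSingularIdeal, genericIdeal, sup_le_iff, Ideal.span_le, Ideal.span_le]
      constructor
      · rintro _ ⟨i, rfl⟩
        change eval₂ _ _ _ = 0
        rw [eval₂_specialize, map_specialize_genericForm (hF i), h0]
      · rintro _ ⟨r, rfl⟩
        have hM : (eval₂Hom ((algebraMap ℝ K).comp (specialize d F)) X₀).mapMatrix
            (Matrix.of fun i j : ι => pderiv (r j) (genericForm σ d i)) =
            Matrix.of fun i j : ι => aeval X₀ (pderiv (r j) (F i)) := by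
          refine Matrix.ext fun i j => ?_
          rw [RingHom.mapMatrix_apply, Matrix.map_apply, Matrix.of_apply, Matrix.of_apply,
            coe_eval₂Hom, eval₂_specialize, ← pderiv_map, map_specialize_genericForm (hF i)]
        exact (RingHom.map_det _ _).trans ((congrArg Matrix.det hM).trans (hdet r))
    exact fun p hp => this hp

omit [Fintype σ] in
theorem pderiv_eq_C_of_isHomogeneous_one {F : MvPolynomial σ ℝ} (hF : F.IsHomogeneous 1) (s : σ) :
    pderiv s F = C (coeff (Finsupp.single s 1) F) := by
  have h := hF.pderiv (i := s)
  rw [← totalDegree_zero_iff_isHomogeneous, totalDegree_eq_zero_iff_eq_C] at h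
  rw [h, coeff_pderiv]
  simp

open Classical in
/-- If the discriminant of a family of forms is nonzero, the gradients of the forms are linearly
independent at every common nonzero zero. -/
theorem linearIndependent_gradient {d : ι → ℕ} {F : ι → MvPolynomial σ ℝ}
    (hF : ∀ i, (F i).IsHomogeneous (d i)) {X₀ : σ → K} (hX : X₀ ≠ 0)
    (h0 : ∀ i, aeval X₀ (F i) = 0) (hΔ : discriminant d F ≠ 0) :
    LinearIndependent K fun i s => aeval X₀ (pderiv s (F i)) := by
  rw [Fintype.linearIndependent_iff]
  by_contra! hc
  obtain ⟨c, hc, i₀, hi₀⟩ := hc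
  have hc0 : c ≠ 0 := fun h => hi₀ (congrFun h i₀)
  have hcs : ∀ s, ∑ i, c i * aeval X₀ (pderiv s (F i)) = 0 := fun s => by
    simpa using congrFun hc s
  apply hΔ
  unfold discriminant
  split_ifs with h1 hcard
  -- The Gram matrix is `A * Aᵀ`, with the constant gradients as rows of `A`; a relation `c` with `c
  -- * A = 0` therefore kills it from the left. The relation lives over `K`, so the determinant is
  -- first moved there.
  · rw [← map_eq_zero_iff _ (algebraMap ℝ K).injective, RingHom.map_det,
      ← Matrix.exists_vecMul_eq_zero_iff]
    refine ⟨c, hc0, funext fun j => ?_⟩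
    simp only [Matrix.vecMul, dotProduct, RingHom.mapMatrix_apply, Matrix.map_apply,
      Matrix.of_apply, Pi.zero_apply, map_sum, map_mul, Finset.mul_sum]
    rw [Finset.sum_comm]
    refine Finset.sum_eq_zero fun s _ => ?_
    simp_rw [← mul_assoc]
    rw [← Finset.sum_mul]
    have := hcs s
    simp_rw [fun i => pderiv_eq_C_of_isHomogeneous_one (h1 i ▸ hF i) s, aeval_C] at this
    rw [this, zero_mul]
  -- For a single form, a nontrivial relation says that its gradient vanishes at `X₀`.
  · refine Finset.prod_eq_zero (Finset.mem_univ i₀) ?_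
    refine resultant_eq_zero (fun s => (hF i₀).pderiv) hX fun s => ?_
    have hu : ∀ i, i = i₀ := fun i => Fintype.card_le_one_iff.mp hcard.le i i₀
    have h2 := hcs s
    rw [Finset.sum_eq_single i₀ (fun i _ hi => absurd (hu i) hi) (by simp)] at h2
    exact (mul_eq_zero.mp h2).resolve_left hi₀
  -- The same `c` is a left kernel vector of every maximal minor.
  · refine evalAtCoeffs_discriminantPoly_eq_zero hF hX h0 fun r => ?_
    rw [← Matrix.exists_vecMul_eq_zero_iff]
    exact ⟨c, hc0, funext fun j => hcs (r j)⟩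

end Elimination

/-! ### Homogenizations on the hyperplanes `x₀ = 1` and `x₀ = 0` -/

section Forms

variable {n : ℕ} {K : Type*} [Field K] [Algebra ℝ K] (p : MvPolynomial (Fin n) ℝ)

theorem topForm_isHomogeneous : (topForm p).IsHomogeneous p.totalDegree :=
  homogeneousComponent_isHomogeneous _ _

theorem homogenization_isHomogeneous : (homogenization p).IsHomogeneous p.totalDegree := by
  refine IsHomogeneous.sum _ _ _ fun k hk => ?_
  have h1 := (isHomogeneous_X_pow (R := ℝ) (0 : Fin (n + 1)) (p.totalDegree - k)).mul
    ((homogeneousComponent_isHomogeneous k p).rename_isHomogeneous (f := Fin.succ))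
  rwa [Nat.sub_add_cancel (by simpa [Nat.lt_succ_iff] using hk)] at h1

theorem aeval_cons_homogenization (t : K) (x : Fin n → K) :
    aeval (Fin.cons t x : Fin (n + 1) → K) (homogenization p) =
      ∑ k ∈ Finset.range (p.totalDegree + 1),
        t ^ (p.totalDegree - k) * aeval x (homogeneousComponent k p) := by
  simp only [homogenization, map_sum, map_mul, map_pow, aeval_X, Fin.cons_zero, aeval_rename]
  rfl

theorem aeval_cons_one_homogenization (x : Fin n → K) :
    aeval (Fin.cons 1 x : Fin (n + 1) → K) (homogenization p) = aeval x p := by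
  rw [aeval_cons_homogenization]
  conv_rhs => rw [← sum_homogeneousComponent p]
  simp

theorem aeval_cons_zero_homogenization (x : Fin n → K) :
    aeval (Fin.cons 0 x : Fin (n + 1) → K) (homogenization p) = aeval x (topForm p) := by
  rw [aeval_cons_homogenization, Finset.sum_range_succ, Finset.sum_eq_zero]
  · simp [topForm]
  · intro k hk
    rw [zero_pow (by have := Finset.mem_range.mp hk; omega), zero_mul]

theorem aeval_cons_one_pderiv_homogenization (x : Fin n → K) (i : Fin n) :
    aeval (Fin.cons 1 x : Fin (n + 1) → K) (pderiv i.succ (homogenization p)) =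
      aeval x (pderiv i p) := by
  conv_rhs => rw [← sum_homogeneousComponent p]
  simp only [homogenization, map_sum]
  refine Finset.sum_congr rfl fun k _ => ?_
  rw [pderiv_mul, pderiv_pow, pderiv_X_of_ne (Fin.succ_ne_zero i).symm,
    pderiv_rename (Fin.succ_injective n)]
  simp only [mul_zero, zero_mul, zero_add, map_mul, map_pow, aeval_X, Fin.cons_zero, one_pow,
    one_mul, aeval_rename]
  rfl

theorem aeval_smul_of_isHomogeneous {σ : Type} [Fintype σ] {F : MvPolynomial σ ℝ} {d : ℕ}
    (hF : F.IsHomogeneous d) (t : K) (x : σ → K) : aeval (t • x) F = t ^ d * aeval x F := by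
  rw [aeval_def, aeval_def, eval₂_eq', eval₂_eq', Finset.mul_sum]
  refine Finset.sum_congr rfl fun α hα => ?_
  have hd : ∑ i, α i = d := by
    rw [← Finsupp.degree_eq_sum]
    by_contra h
    exact mem_support_iff.mp hα (hF.coeff_eq_zero h)
  simp only [Pi.smul_apply, smul_eq_mul, mul_pow, Finset.prod_mul_distrib, Finset.prod_pow_eq_pow_sum,
    hd]
  ring

omit [Algebra ℝ K] in
theorem cons_one_ne_zero (x : Fin n → K) : (Fin.cons 1 x : Fin (n + 1) → K) ≠ 0 := fun h => by
  simpa using congrFun h 0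

theorem affineResultant_eq_zero {ι : Type} [Fintype ι] {p : ι → MvPolynomial (Fin n) ℝ}
    {x : Fin n → K} (h0 : ∀ i, aeval x (p i) = 0) : affineResultant p = 0 :=
  resultant_eq_zero (fun i => homogenization_isHomogeneous (p i)) (cons_one_ne_zero x)
    fun i => by rw [aeval_cons_one_homogenization, h0]

theorem linearIndependent_gradient_of_affineDiscriminant {ι : Type} [Fintype ι]
    {p : ι → MvPolynomial (Fin n) ℝ} {x : Fin n → K} (h0 : ∀ i, aeval x (p i) = 0)
    (hΔ : affineDiscriminant p ≠ 0) :
    LinearIndependent K fun t i => aeval x (pderiv i (p t)) := by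
  have h0' : ∀ t, aeval (Fin.cons 1 x : Fin (n + 1) → K) (homogenization (p t)) = 0 := fun t => by
    rw [aeval_cons_one_homogenization, h0]
  have h := linearIndependent_gradient (fun i => homogenization_isHomogeneous (p i))
    (cons_one_ne_zero x) h0' hΔ
  rw [Fintype.linearIndependent_iff] at h ⊢
  intro c hc
  have hcs : ∀ i : Fin n, ∑ t, c t * aeval x (pderiv i (p t)) = 0 := fun s => by
    simpa using congrFun hc s
  refine h c (funext fun s => ?_)
  simp only [Finset.sum_apply, Pi.smul_apply, smul_eq_mul, Pi.zero_apply]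
  refine Fin.cases ?_ (fun i => ?_) s
  -- Euler's identity at a zero with `x₀ = 1` expresses the extra partial derivative through the
  -- affine ones, so a relation among affine gradients extends to the homogenized ones.
  · have hE : ∀ t, aeval (Fin.cons 1 x : Fin (n + 1) → K) (pderiv 0 (homogenization (p t))) =
        - ∑ i : Fin n, x i * aeval x (pderiv i (p t)) := fun t => by
      have h1 := congrArg (aeval (Fin.cons 1 x : Fin (n + 1) → K))
        (homogenization_isHomogeneous (p t)).sum_X_mul_pderiv
      rw [map_nsmul, h0', smul_zero, map_sum, Fin.sum_univ_succ] at h1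
      simp only [map_mul, aeval_X, Fin.cons_zero, Fin.cons_succ, one_mul,
        aeval_cons_one_pderiv_homogenization] at h1
      exact eq_neg_of_add_eq_zero_left h1
    simp_rw [hE, mul_neg, Finset.mul_sum]
    rw [Finset.sum_neg_distrib, Finset.sum_comm, neg_eq_zero]
    refine Finset.sum_eq_zero fun i _ => ?_
    simp_rw [mul_left_comm (c _)]
    rw [← Finset.mul_sum, hcs, mul_zero]
  · simp_rw [aeval_cons_one_pderiv_homogenization]
    exact hcs i

end Forms

/-! ### Real geometry: open maps, compactness and points at infinity -/

section Real

variable {n : ℕ}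

theorem hasStrictFDerivAt_eval (p : MvPolynomial (Fin n) ℝ) (y : Fin n → ℝ) :
    HasStrictFDerivAt (fun x => eval x p)
      (∑ s, eval y (pderiv s p) • ContinuousLinearMap.proj (R := ℝ) (φ := fun _ => ℝ) s) y := by
  induction p using MvPolynomial.induction_on with
  | C a => simpa using hasStrictFDerivAt_const (𝕜 := ℝ) a y
  | add p q hp hq =>
    simp only [map_add, add_smul, Finset.sum_add_distrib]
    exact hp.add hq
  | mul_X p i hp =>
    simp only [map_mul, eval_X]
    refine (hp.mul (ContinuousLinearMap.proj (R := ℝ) (φ := fun _ => ℝ)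
      i).hasStrictFDerivAt).congr_fderiv ?_
    ext v
    simp only [pderiv_mul, map_add, map_mul, eval_X, pderiv_X, add_smul, Finset.sum_add_distrib,
      add_apply, sum_apply, smul_apply,
      ContinuousLinearMap.proj_apply, smul_eq_mul, Finset.mul_sum]
    rw [add_comm]
    congr 1
    · exact Finset.sum_congr rfl fun s _ => by ring
    · rw [Finset.sum_eq_single i]
      · simp
      · intro s _ hs
        simp [hs]
      · simp

/-- A polynomial map whose components have linearly independent gradients at a point is open
there. -/
theorem map_nhds_eval_eq {ι : Type} [Fintype ι] (p : ι → MvPolynomial (Fin n) ℝ) (y : Fin n → ℝ)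
    (hy : LinearIndependent ℝ fun i s => eval y (pderiv s (p i))) :
    Filter.map (fun x i => eval x (p i)) (nhds y) = nhds fun i => eval y (p i) := by
  have hd : HasStrictFDerivAt (fun x i => eval x (p i))
      (ContinuousLinearMap.pi fun i => ∑ s, eval y (pderiv s (p i)) •
        ContinuousLinearMap.proj (R := ℝ) (φ := fun _ => ℝ) s) y :=
    hasStrictFDerivAt_pi.mpr fun i => hasStrictFDerivAt_eval (p i) y
  refine hd.map_nhds_eq_of_surj ?_
  set M : Matrix ι (Fin n) ℝ := Matrix.of fun i s => eval y (pderiv s (p i)) with hM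
  -- Independent rows give full row rank, that is, a surjective derivative.
  have hrange : LinearMap.range M.mulVecLin = ⊤ := by
    apply Submodule.eq_top_of_finrank_eq
    rw [Module.finrank_fintype_fun_eq_card]
    exact LinearIndependent.rank_matrix (M := M) hy
  rw [← hrange]
  congr 1
  ext v i
  simp [hM, Matrix.mulVec, dotProduct]

variable {m₁ m₂ : ℕ} {h : Fin m₁ → MvPolynomial (Fin n) ℝ} {g : Fin m₂ → MvPolynomial (Fin n) ℝ}
  {f : MvPolynomial (Fin n) ℝ}

theorem isClosed_feasibleSet : IsClosed (feasibleSet h g) := by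
  simp only [feasibleSet, Set.ofPred_and, Set.ofPred_forall]
  exact (isClosed_iInter fun i => isClosed_eq (MvPolynomial.continuous_eval _) continuous_const).inter
    (isClosed_iInter fun j => isClosed_le continuous_const (MvPolynomial.continuous_eval _))

theorem eval_cons_zero_homogenization (p : MvPolynomial (Fin n) ℝ) (x : Fin n → ℝ) :
    eval (Fin.cons 0 x : Fin (n + 1) → ℝ) (homogenization p) = eval x (topForm p) :=
  aeval_cons_zero_homogenization p x

theorem eval_smul_cons_one_homogenization (p : MvPolynomial (Fin n) ℝ) (t : ℝ) (x : Fin n → ℝ) :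
    eval (t • (Fin.cons 1 x : Fin (n + 1) → ℝ)) (homogenization p) =
      t ^ p.totalDegree * eval x p := by
  have := aeval_smul_of_isHomogeneous (homogenization_isHomogeneous p) t (Fin.cons 1 x)
  rwa [aeval_cons_one_homogenization] at this

theorem cons_zero_mem_projectivization {y : Fin n → ℝ} :
    (Fin.cons 0 y : Fin (n + 1) → ℝ) ∈ projectivization h g ↔
      y ∈ feasibleSet (fun i => topForm (h i)) fun j => topForm (g j) := by
  simp [projectivization, feasibleSet, eval_cons_zero_homogenization]

theorem smul_cons_one_mem_projectivization {t : ℝ} (ht : 0 ≤ t) {x : Fin n → ℝ}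
    (hx : x ∈ feasibleSet h g) :
    t • (Fin.cons 1 x : Fin (n + 1) → ℝ) ∈ projectivization h g := by
  refine ⟨fun i => ?_, fun j => ?_⟩
  · simp only [eval_smul_cons_one_homogenization, hx.1, mul_zero]
  · simp only [eval_smul_cons_one_homogenization]
    exact mul_nonneg (pow_nonneg ht _) (hx.2 j)

/-- Dividing by `z 0` multiplies each homogenized constraint by a positive factor, which preserves
equations and signs. -/
theorem exists_smul_cons_one_of_mem_projectivization {z : Fin (n + 1) → ℝ}
    (hz : z ∈ projectivization h g) (hz0 : 0 < z 0) :
    ∃ x ∈ feasibleSet h g, z = z 0 • (Fin.cons 1 x : Fin (n + 1) → ℝ) := by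
  have hzx : z = z 0 • (Fin.cons 1 ((z 0)⁻¹ • Fin.tail z) : Fin (n + 1) → ℝ) := by
    funext s
    refine Fin.cases ?_ (fun i => ?_) s
    · simp
    · simp [Fin.tail, hz0.ne']
  refine ⟨(z 0)⁻¹ • Fin.tail z, ⟨fun i => ?_, fun j => ?_⟩, hzx⟩
  · have h1 := hz.1 i
    rw [hzx, eval_smul_cons_one_homogenization] at h1
    exact (mul_eq_zero.mp h1).resolve_left (pow_ne_zero _ hz0.ne')
  · have h1 := hz.2 j
    rw [hzx, eval_smul_cons_one_homogenization] at h1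
    exact nonneg_of_mul_nonneg_right h1 (pow_pos hz0 _)

/-- If the top form of `f` is positive on the feasible set at infinity, then `f` attains its
minimum on the feasible set. -/
theorem exists_isMinOn_of_topForm_pos (hS : (feasibleSet h g).Nonempty) (hd : f.totalDegree ≠ 0)
    (hpos : ∀ y ∈ feasibleSet (fun i => topForm (h i)) (fun j => topForm (g j)), y ≠ 0 →
      0 < eval y (topForm f)) :
    ∃ v ∈ feasibleSet h g, IsMinOn (fun x => eval x f) (feasibleSet h g) v := by
  obtain ⟨u, hu⟩ := hS
  -- `D` contains every feasible `x` with `f x ≤ f u` and `‖x‖ > 1`, rescaled to `(1 / ‖x‖, x /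
  -- ‖x‖)`. It is compact and, by positivity at infinity, misses `x₀ = 0`; a lower bound `m` for
  -- `x₀` on `D` then bounds `‖x‖` by `m⁻¹`.
  set D : Set (Fin (n + 1) → ℝ) := projectivization h g ∩
    {z | eval z (homogenization f) ≤ eval u f * z 0 ^ f.totalDegree} ∩
    {z | 0 ≤ z 0 ∧ z 0 ≤ 1 ∧ ‖Fin.tail z‖ = 1} with hD
  have htail : Continuous (Fin.tail : (Fin (n + 1) → ℝ) → Fin n → ℝ) :=
    continuous_pi fun i => continuous_apply i.succ
  have hDclosed : IsClosed D := by
    refine (isClosed_feasibleSet.inter (isClosed_le (MvPolynomial.continuous_eval _)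
      (by fun_prop))).inter ?_
    exact (isClosed_le continuous_const (continuous_apply 0)).inter
      ((isClosed_le (continuous_apply 0) continuous_const).inter
        (isClosed_eq htail.norm continuous_const))
  have hDbdd : Bornology.IsBounded D := by
    refine (Metric.isBounded_closedBall (x := (0 : Fin (n + 1) → ℝ)) (r := 1)).subset ?_
    rintro z ⟨_, h0, h1, h2⟩
    rw [mem_closedBall_zero_iff, pi_norm_le_iff_of_nonneg zero_le_one]
    refine fun s => Fin.cases ?_ (fun i => ?_) s
    · rwa [Real.norm_of_nonneg h0]
    · exact (norm_le_pi_norm (Fin.tail z) i).trans h2.le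
  have hDpos : ∀ z ∈ D, 0 < z 0 := by
    rintro z ⟨⟨hz, hf⟩, h0, h1, h2⟩
    refine lt_of_le_of_ne h0 fun h3 => ?_
    have hzc : z = Fin.cons 0 (Fin.tail z) := by
      rw [h3]; exact (Fin.cons_self_tail z).symm
    have hy : Fin.tail z ≠ 0 := fun h => by simp [h] at h2
    have hlt := hpos _ (cons_zero_mem_projectivization.mp (hzc ▸ hz)) hy
    -- Since the degree is nonzero, the bound `f u * x₀ ^ deg f` vanishes at infinity.
    rw [Set.mem_ofPred_eq, ← h3, zero_pow hd, mul_zero, hzc, eval_cons_zero_homogenization] at hf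
    exact hlt.not_ge hf
  -- This form of the extreme value theorem also covers empty `D`.
  obtain ⟨m, hm, hmD⟩ := (Metric.isCompact_of_isClosed_isBounded hDclosed hDbdd).exists_forall_le'
    (continuous_apply 0).continuousOn hDpos
  have hbound : feasibleSet h g ∩ {x | eval x f ≤ eval u f} ⊆ Metric.closedBall 0 (max 1 m⁻¹) := by
    rintro x ⟨hx, hfx⟩
    rw [mem_closedBall_zero_iff]
    by_contra! hlt
    have h1 : 1 < ‖x‖ := (le_max_left _ _).trans_lt hlt
    have h0 : 0 < ‖x‖ := zero_lt_one.trans h1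
    have hzD : ‖x‖⁻¹ • (Fin.cons 1 x : Fin (n + 1) → ℝ) ∈ D := by
      refine ⟨⟨smul_cons_one_mem_projectivization (inv_nonneg.mpr h0.le) hx, ?_⟩, ?_, ?_, ?_⟩
      · rw [Set.mem_ofPred_eq, eval_smul_cons_one_homogenization, mul_comm]
        simp only [Pi.smul_apply, Fin.cons_zero, smul_eq_mul, mul_one]
        exact mul_le_mul_of_nonneg_right hfx (by positivity)
      · simp
      · simpa using inv_le_one_of_one_le₀ h1.le
      · have : Fin.tail (‖x‖⁻¹ • (Fin.cons 1 x : Fin (n + 1) → ℝ)) = ‖x‖⁻¹ • x := by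
          ext i; simp [Fin.tail]
        rw [this, norm_smul, norm_inv, norm_norm, inv_mul_cancel₀ h0.ne']
    have h4 := hmD _ hzD
    simp only [Pi.smul_apply, Fin.cons_zero, smul_eq_mul, mul_one] at h4
    exact ((le_max_right _ _).trans_lt hlt).not_ge ((le_inv_comm₀ hm h0).mp h4)
  have hcompact : IsCompact (feasibleSet h g ∩ {x | eval x f ≤ eval u f}) :=
    (isCompact_closedBall 0 _).of_isClosed_subset (isClosed_feasibleSet.inter
      (isClosed_le (MvPolynomial.continuous_eval _) continuous_const)) hbound
  obtain ⟨v, hv, hmin⟩ := hcompact.exists_isMinOn ⟨u, hu, le_refl (eval u f)⟩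
    (MvPolynomial.continuous_eval f).continuousOn
  refine ⟨v, hv.1, fun x hx => ?_⟩
  by_cases hxu : eval x f ≤ eval u f
  · exact hmin ⟨hx, hxu⟩
  · exact le_trans hv.2 (not_le.mp hxu).le

/-- A nonconstant polynomial bounded below on a feasible set closed at infinity has a nonnegative
top form on the feasible set at infinity. -/
theorem topForm_nonneg (hcl : ClosedAtInfinity h g)
    (hb : BddBelow ((fun x => eval x f) '' feasibleSet h g)) (hd : f.totalDegree ≠ 0)
    {y : Fin n → ℝ}
    (hy : y ∈ feasibleSet (fun i => topForm (h i)) fun j => topForm (g j)) :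
    0 ≤ eval y (topForm f) := by
  obtain ⟨c, hc⟩ := hb
  -- The lower bound `c` for `f` homogenizes to a closed condition, which survives passage to the
  -- closure and loses its left side at `x₀ = 0`.
  have hsub : closure (projectivization h g ∩ {x | 0 < x 0}) ⊆
      {z | c * z 0 ^ f.totalDegree ≤ eval z (homogenization f)} := by
    refine closure_minimal ?_ (isClosed_le (by fun_prop) (MvPolynomial.continuous_eval _))
    rintro z ⟨hz, hz0⟩
    obtain ⟨x, hx, hzx⟩ := exists_smul_cons_one_of_mem_projectivization hz hz0
    rw [Set.mem_ofPred_eq, congrArg (fun w => eval w (homogenization f)) hzx,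
      eval_smul_cons_one_homogenization, mul_comm]
    exact mul_le_mul_of_nonneg_left (hc ⟨x, hx, rfl⟩) (pow_pos hz0 _).le
  have hmem : (Fin.cons 0 y : Fin (n + 1) → ℝ) ∈ projectivization h g ∩ {x | 0 ≤ x 0} :=
    ⟨cons_zero_mem_projectivization.mpr hy, by simp⟩
  rw [hcl] at hmem
  simpa [zero_pow hd, eval_cons_zero_homogenization] using hsub hmem

theorem closedAtInfinity_of_isEmpty (h : Fin 0 → MvPolynomial (Fin n) ℝ)
    (g : Fin 0 → MvPolynomial (Fin n) ℝ) : ClosedAtInfinity h g := by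
  have hu : projectivization h g = Set.univ :=
    Set.eq_univ_of_forall fun z => ⟨fun i => i.elim0, fun i => i.elim0⟩
  rw [ClosedAtInfinity, hu, Set.univ_inter, Set.univ_inter]
  refine Set.Subset.antisymm (fun z hz => ?_)
    (closure_minimal (fun z (hz : 0 < z 0) => hz.le) (isClosed_le continuous_const (continuous_apply 0)))
  -- Without constraints a point of the closed half-space is approached by raising `x₀`.
  have ht : Filter.Tendsto (fun t : ℝ => z + t • (Pi.single 0 1 : Fin (n + 1) → ℝ))
      (nhdsWithin 0 (Set.Ioi 0)) (nhds z) := by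
    have : Continuous fun t : ℝ => z + t • (Pi.single 0 1 : Fin (n + 1) → ℝ) := by fun_prop
    simpa using (this.tendsto 0).mono_left nhdsWithin_le_nhds
  refine mem_closure_of_tendsto ht ?_
  filter_upwards [self_mem_nhdsWithin] with t ht
  simpa using add_pos_of_nonneg_of_pos hz ht

theorem exists_isMinOn_of_totalDegree_eq_zero (hS : (feasibleSet h g).Nonempty)
    (hd : f.totalDegree = 0) :
    ∃ v ∈ feasibleSet h g, IsMinOn (fun x => eval x f) (feasibleSet h g) v := by
  obtain ⟨u, hu⟩ := hS
  rw [totalDegree_eq_zero_iff_eq_C] at hd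
  refine ⟨u, hu, fun x _ => ?_⟩
  rw [hd]
  simp

/-- At a common zero of `f`, the `h i` and the `g j` with `j ∈ J` where all other `g j` are
positive and the gradients are independent, `f` takes negative values at nearby feasible points. -/
theorem exists_eval_neg_of_linearIndependent {J : Finset (Fin m₂)} {y : Fin n → ℝ}
    (h0 : ∀ o, eval y (objectiveTuple h g f J o) = 0) (hJ : ∀ j ∉ J, 0 < eval y (g j))
    (hy : LinearIndependent ℝ fun o s => eval y (pderiv s (objectiveTuple h g f J o))) :
    ∃ x ∈ feasibleSet h g, eval x f < 0 := by
  have hmap := map_nhds_eval_eq _ y hy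
  simp_rw [h0] at hmap
  have hev : ∀ᶠ x in nhds y, ∀ j ∉ J, 0 < eval x (g j) := by
    refine Filter.eventually_all.mpr fun j => ?_
    by_cases hj : j ∈ J
    · simp [hj]
    · filter_upwards [(MvPolynomial.continuous_eval (g j)).continuousAt.eventually
        (lt_mem_nhds (hJ j hj))] with x hx _ using hx
  have himg := hmap ▸ Filter.image_mem_map hev
  -- By openness the values `(t, 0, …, 0)` with small `t < 0` are attained near `y`: `f` is
  -- negative, the active constraints stay zero, and the others stay positive.
  have ht : Filter.Tendsto (fun t : ℝ => fun o : Option (Fin m₁ ⊕ ↥J) => o.elim t fun _ => (0 : ℝ))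
      (nhdsWithin 0 (Set.Iio 0)) (nhds fun _ => 0) := by
    rw [tendsto_pi_nhds]
    rintro (_ | o)
    · exact Filter.tendsto_id.mono_left nhdsWithin_le_nhds
    · exact tendsto_const_nhds
  obtain ⟨t, ⟨x, hx, hxt⟩, ht0⟩ :=
    ((ht.eventually himg).and (self_mem_nhdsWithin : Set.Iio (0 : ℝ) ∈ _)).exists
  have hx' : ∀ o, eval x (objectiveTuple h g f J o) = o.elim t fun _ => (0 : ℝ) := congrFun hxt
  refine ⟨x, ⟨fun i => hx' (some (Sum.inl i)), fun j => ?_⟩, (hx' none).trans_lt ht0⟩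
  by_cases hj : j ∈ J
  · exact (hx' (some (Sum.inr ⟨j, hj⟩))).ge
  · exact (hx j hj).le

end Real

/-! ### The five assertions -/

section Parts

variable {n m₁ m₂ : ℕ} {h : Fin m₁ → MvPolynomial (Fin n) ℝ} {g : Fin m₂ → MvPolynomial (Fin n) ℝ}
  {f : MvPolynomial (Fin n) ℝ}

theorem feasibleSet_eq_empty_of_affineResultant_ne_zero {I : Finset (Fin m₁)}
    (hI : affineResultant (fun i : ↥I => h i) ≠ 0) : feasibleSet h g = ∅ :=
  Set.eq_empty_of_forall_notMem fun x hx =>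
    hI (affineResultant_eq_zero (K := ℝ) (x := x) fun i => hx.1 i)

theorem fewActive_of_affineResultant_ne_zero
    (hR : ∀ J : Finset (Fin m₂), J.card = n - m₁ + 1 →
      affineResultant (constraintTuple h g J) ≠ 0) : FewActive h g := by
  classical
  intro u hu
  by_contra! hlt
  obtain ⟨J, hJ, hcard⟩ := Finset.exists_subset_card_eq (Nat.succ_le_of_lt hlt)
  refine hR J hcard (affineResultant_eq_zero (K := ℝ) (x := u) ?_)
  rintro (i | j)
  · exact hu.1 i
  · have := hJ j.2
    simp only [Finset.mem_filter] at this
    exact this.2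

theorem nonsingularVarieties_of_affineDiscriminant_ne_zero
    (hΔ : ∀ J : Finset (Fin m₂), J.card ≤ n - m₁ →
      affineDiscriminant (constraintTuple h g J) ≠ 0) : NonsingularVarieties h g := by
  intro J hJ x hx
  have hli := linearIndependent_gradient_of_affineDiscriminant hx (hΔ J hJ)
  rw [Matrix.rank_eq_finrank_span_cols]
  refine (finrank_span_eq_card hli).trans ?_
  simp

theorem topForm_objectiveTuple (J : Finset (Fin m₂)) (o : Option (Fin m₁ ⊕ ↥J)) :
    topForm (objectiveTuple h g f J o) =
      objectiveTuple (fun i => topForm (h i)) (fun j => topForm (g j)) (topForm f) J o := by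
  rcases o with _ | _ | _ <;> rfl

theorem linearIndependent_gradient_of_topDiscriminant {ι : Type} [Fintype ι]
    {p : ι → MvPolynomial (Fin n) ℝ} {y : Fin n → ℝ} (hy : y ≠ 0)
    (h0 : ∀ i, eval y (topForm (p i)) = 0) (hΔ : topDiscriminant p ≠ 0) :
    LinearIndependent ℝ fun i s => eval y (pderiv s (topForm (p i))) :=
  linearIndependent_gradient (K := ℝ) (fun i => topForm_isHomogeneous (p i)) hy h0 hΔ

theorem exists_isMinOn_of_topDiscriminant_ne_zero (hS : (feasibleSet h g).Nonempty)
    (hcl : ClosedAtInfinity h g) (hb : BddBelow ((fun x => eval x f) '' feasibleSet h g))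
    (hR : ∀ T : Finset (Fin m₁ ⊕ Fin m₂), T.card = n →
      topResultant (fun t : ↥T => Sum.elim h g t) ≠ 0)
    (hΔ : ∀ J : Finset (Fin m₂), m₁ + J.card + 1 ≤ n →
      topDiscriminant (objectiveTuple h g f J) ≠ 0) :
    ∃ v ∈ feasibleSet h g, IsMinOn (fun x => eval x f) (feasibleSet h g) v := by
  classical
  by_cases hd : f.totalDegree = 0
  · exact exists_isMinOn_of_totalDegree_eq_zero hS hd
  refine exists_isMinOn_of_topForm_pos hS hd fun y hy hy0 => ?_
  refine (topForm_nonneg hcl hb hd hy).lt_of_ne' fun hfy => ?_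
  -- The inequalities active at infinity. With `m₁ + J.card ≥ n`, some `n` top forms would share the
  -- zero `y`, against the resultant condition.
  set J : Finset (Fin m₂) := Finset.univ.filter fun j => eval y (topForm (g j)) = 0 with hJ
  have hcard : m₁ + J.card + 1 ≤ n := by
    by_contra! hlt
    have hle : n ≤ ((Finset.univ : Finset (Fin m₁)).disjSum J).card := by
      rw [Finset.card_disjSum, Finset.card_fin]
      omega
    obtain ⟨T, hT, hTn⟩ := Finset.exists_subset_card_eq hle
    refine hR T hTn (resultant_eq_zero (K := ℝ) (fun t => topForm_isHomogeneous _) hy0 ?_)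
    rintro ⟨i | j, ht⟩
    · exact hy.1 i
    · have := hT ht
      rw [Finset.inr_mem_disjSum, hJ, Finset.mem_filter] at this
      exact this.2
  have h0 : ∀ o, eval y (topForm (objectiveTuple h g f J o)) = 0 := by
    rintro (_ | i | j)
    · exact hfy
    · exact hy.1 i
    · exact (Finset.mem_filter.mp j.2).2
  have hli := linearIndependent_gradient_of_topDiscriminant hy0 h0 (hΔ J hcard)
  -- The perturbation lemma is applied to the system of top forms, so that the new point is again
  -- feasible at infinity.
  simp_rw [topForm_objectiveTuple] at h0 hli
  obtain ⟨x, hx, hfx⟩ := exists_eval_neg_of_linearIndependent h0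
    (fun j hj => (hy.2 j).lt_of_ne' fun h => hj (by simp [hJ, h])) hli
  exact hfx.not_ge (topForm_nonneg hcl hb hd hx)

theorem feasibleSet_of_isEmpty (h : Fin 0 → MvPolynomial (Fin n) ℝ)
    (g : Fin 0 → MvPolynomial (Fin n) ℝ) : feasibleSet h g = Set.univ :=
  Set.eq_univ_of_forall fun _ => ⟨fun i => i.elim0, fun i => i.elim0⟩

theorem exists_isMinOn_of_formDiscriminant_ne_zero
    (hb : BddBelow (Set.range fun x : Fin n → ℝ => eval x f))
    (hΔ : formDiscriminant f.totalDegree (topForm f) ≠ 0) :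
    ∃ v : Fin n → ℝ, IsMinOn (fun x => eval x f) Set.univ v := by
  have hu := feasibleSet_of_isEmpty (n := n) Fin.elim0 Fin.elim0
  suffices H : ∃ v ∈ feasibleSet (n := n) Fin.elim0 Fin.elim0,
      IsMinOn (fun x => eval x f) (feasibleSet Fin.elim0 Fin.elim0) v by
    obtain ⟨v, -, hv⟩ := H
    exact ⟨v, hu ▸ hv⟩
  have hS : (feasibleSet (n := n) Fin.elim0 Fin.elim0).Nonempty := hu ▸ Set.univ_nonempty
  by_cases hd : f.totalDegree = 0
  · exact exists_isMinOn_of_totalDegree_eq_zero hS hd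
  have hnonneg : ∀ y, 0 ≤ eval y (topForm f) := fun y =>
    topForm_nonneg (closedAtInfinity_of_isEmpty Fin.elim0 Fin.elim0)
      (by rwa [hu, Set.image_univ]) hd
      ⟨fun i => i.elim0, fun i => i.elim0⟩
  refine exists_isMinOn_of_topForm_pos hS hd fun y _ hy0 => ?_
  refine (hnonneg y).lt_of_ne' fun hfy => hΔ ?_
  refine resultant_eq_zero (K := ℝ) (fun s => (topForm_isHomogeneous f).pderiv) hy0 fun s => ?_
  -- A zero of a nonnegative form is a minimum, so Fermat's theorem makes all partial derivatives
  -- vanish there.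
  have hmin : IsLocalMin (fun x => eval x (topForm f)) y :=
    Filter.Eventually.of_forall fun x => hfy.trans_le (hnonneg x)
  have h1 := hmin.hasFDerivAt_eq_zero (hasStrictFDerivAt_eval (topForm f) y).hasFDerivAt
  have h2 := congrArg (fun L => L (Pi.single s 1)) h1
  simpa [Pi.single_apply] using h2

end Parts

end PolyOpt

theorem mainTheorem3 {n m₁ m₂ : ℕ} (f : MvPolynomial (Fin n) ℝ)
    (h : Fin m₁ → MvPolynomial (Fin n) ℝ) (g : Fin m₂ → MvPolynomial (Fin n) ℝ) :
    -- (a)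
    (n < m₁ →
      (∃ I : Finset (Fin m₁), I.card = n + 1 ∧
        PolyOpt.affineResultant (fun i : ↥I => h i) ≠ 0) →
      PolyOpt.feasibleSet h g = ∅) ∧
    -- (b)
    (m₁ ≤ n →
      (∀ J : Finset (Fin m₂), J.card = n - m₁ + 1 →
        PolyOpt.affineResultant (PolyOpt.constraintTuple h g J) ≠ 0) →
      PolyOpt.FewActive h g) ∧
    -- (c)
    (m₁ ≤ n →
      (∀ J : Finset (Fin m₂), J.card ≤ n - m₁ →
        PolyOpt.affineDiscriminant (PolyOpt.constraintTuple h g J) ≠ 0) →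
      PolyOpt.NonsingularVarieties h g) ∧
    -- (d)
    ((PolyOpt.feasibleSet h g).Nonempty →
      PolyOpt.ClosedAtInfinity h g →
      BddBelow ((fun x => eval x f) '' PolyOpt.feasibleSet h g) →
      (∀ T : Finset (Fin m₁ ⊕ Fin m₂), T.card = n →
        PolyOpt.topResultant (fun t : ↥T => Sum.elim h g t) ≠ 0) →
      (∀ J : Finset (Fin m₂), m₁ + J.card + 1 ≤ n →
        PolyOpt.topDiscriminant (PolyOpt.objectiveTuple h g f J) ≠ 0) →
      ∃ v ∈ PolyOpt.feasibleSet h g, IsMinOn (fun x => eval x f) (PolyOpt.feasibleSet h g) v) ∧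
    -- (e)
    (BddBelow (Set.range fun x : Fin n → ℝ => eval x f) →
      PolyOpt.formDiscriminant f.totalDegree (PolyOpt.topForm f) ≠ 0 →
      ∃ v : Fin n → ℝ, IsMinOn (fun x => eval x f) Set.univ v) := by
  exact ⟨fun _ ⟨_, _, hI⟩ => PolyOpt.feasibleSet_eq_empty_of_affineResultant_ne_zero hI,
    fun _ => PolyOpt.fewActive_of_affineResultant_ne_zero,
    fun _ => PolyOpt.nonsingularVarieties_of_affineDiscriminant_ne_zero,
    PolyOpt.exists_isMinOn_of_topDiscriminant_ne_zero,
    PolyOpt.exists_isMinOn_of_formDiscriminant_ne_zero⟩
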